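/- Let $A$ be a unital separable $C^*$-algebra whose trace space $T(A)$ (the set of tracial states of $A$) is nonempty, let $\Gamma$ be a countable discrete amenable group, let $\alpha:\Gamma\to\mathrm{Aut}(A)$, $g\mapsto\alpha^g$, be a group action by $*$-automorphisms, and let $\omega$ be a free ultrafilter on $\mathbb N$. Let $$A_\omega=\ell^\infty(\mathbb N,A)\big/\{(a_n):\lim_{n\to\omega}\|a_n\|=0\}$$ be the ultrapower of $A$, with the action $\alpha_\omega$ of $\Gamma$ given by $(\alpha_\omega)^g[(a_n)]=[(\alpha^g(a_n))]$. For $a=[(a_n)]\in A_\omega$ put $\|a\|_{2,\omega}=\lim_{n\to\omega}\sup_{\tau\in T(A)}\tau(a_n^*a_n)^{1/2}$, and let $J_A=\{e\in A_\omega:\|e\|_{2,\omega}=0\}$ be the trace-kernel ideal. Then $J_A$ is an $\alpha_\omega$-$\sigma$-ideal of $A_\omega$. That is, $J_A$ is a closed two-sided ideal of $A_\omega$ with $(\alpha_\omega)^g(J_A)=J_A$ for every $g\in\Gamma$, and for every separable $C^*$-subalgebra $C$ of $A_\omega$ satisfying $(\alpha_\omega)^g(C)=C$ for every $g\in\Gamma$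 there exists a positive contraction $u\in C'\cap J_A$ such that 1. $(\alpha_\omega)^g(u)=u$ for every $g\in\Gamma$; 2. $uc=c$ for every $c\in C\cap J_A$. Here $C'$ is the set of elements of $A_\omega$ that commute with every element of $C$, and $C$ is not required to contain the unit of $A_\omega$. -/

import Mathlib

open scoped BoundedContinuousFunction ComplexOrder

noncomputable section

namespace TraceKernel

/-! ### The C⋆-algebraic ultrapower

`ℕ →ᵇ A` (with `ℕ` discrete) is the C⋆-algebra of bounded sequences in `A`. -/

section Ultrapower

variable (A : Type*) [CStarAlgebra A] (ω : Ultrafilter ℕ)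

/-- The ideal of all bounded sequences `(aₙ)` in `A` with `lim_{n → ω} ‖aₙ‖ = 0`. -/
def nullIdeal : Ideal (ℕ →ᵇ A) where
  carrier := {a | Filter.Tendsto (fun n => ‖a n‖) ω (nhds 0)}
  zero_mem' := by simp
  add_mem' := by
    intro a b ha hb
    refine squeeze_zero (fun _ => norm_nonneg _) (fun n => norm_add_le (a n) (b n)) ?_
    simpa using ha.add hb
  smul_mem' := by
    intro c a ha
    refine squeeze_zero (fun _ => norm_nonneg _)
      (fun n => (norm_mul_le (c n) (a n)).trans
        (mul_le_mul_of_nonneg_right (c.norm_coe_le_norm n) (norm_nonneg _))) ?_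
    simpa using ha.const_mul ‖c‖

variable {A} in
theorem mem_nullIdeal {a : ℕ →ᵇ A} :
    a ∈ nullIdeal A ω ↔ Filter.Tendsto (fun n => ‖a n‖) ω (nhds 0) := Iff.rfl

instance : (nullIdeal A ω).IsTwoSided where
  mul_mem_of_left := by
    intro a b ha
    refine squeeze_zero (fun _ => norm_nonneg _)
      (fun n => (norm_mul_le (a n) (b n)).trans
        (mul_le_mul_of_nonneg_left (b.norm_coe_le_norm n) (norm_nonneg _))) ?_
    simpa using Filter.Tendsto.mul_const ‖b‖ ha

variable {A} in
theorem star_mem_nullIdeal {a : ℕ →ᵇ A} (ha : a ∈ nullIdeal A ω) : star a ∈ nullIdeal A ω := by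
  rw [mem_nullIdeal] at ha ⊢
  simpa using ha

variable {A} in
/-- If `lim_{n → ω} ‖aₙ‖ < r`, then `a` is equal, modulo null sequences, to a sequence that is
bounded by `r`. -/
theorem exists_sub_mem_nullIdeal (a : ℕ →ᵇ A) {r : ℝ} (hr : 0 ≤ r)
    (h : ∀ᶠ n in (ω : Filter ℕ), ‖a n‖ ≤ r) : ∃ b : ℕ →ᵇ A, ‖b‖ ≤ r ∧ a - b ∈ nullIdeal A ω := by
  classical
  let b : ℕ →ᵇ A := BoundedContinuousFunction.ofNormedAddCommGroupDiscrete
    (fun n => if ‖a n‖ ≤ r then a n else 0) r (by intro n; split_ifs <;> simpa)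
  refine ⟨b, BoundedContinuousFunction.norm_ofNormedAddCommGroup_le _ hr _, ?_⟩
  rw [mem_nullIdeal]
  refine tendsto_const_nhds.congr' ?_
  filter_upwards [h] with n hn
  have : b n = a n := if_pos hn
  simp [this]

instance : IsClosed (nullIdeal A ω : Set (ℕ →ᵇ A)) := by
  refine isClosed_of_closure_subset fun a ha => ?_
  change a ∈ nullIdeal A ω
  rw [mem_nullIdeal, Metric.tendsto_nhds]
  intro ε hε
  obtain ⟨b, hb, hab⟩ := Metric.mem_closure_iff.1 ha (ε / 2) (half_pos hε)
  filter_upwards [Metric.tendsto_nhds.1 ((mem_nullIdeal ω).1 hb) (ε / 2) (half_pos hε)] with n hn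
  have h1 : ‖a n - b n‖ < ε / 2 := by
    refine lt_of_le_of_lt ?_ (dist_eq_norm a b ▸ hab)
    exact (a - b).norm_coe_le_norm n
  have h2 : ‖a n‖ ≤ ‖a n - b n‖ + ‖b n‖ := by simpa using norm_add_le (a n - b n) (b n)
  simp only [dist_zero_right, norm_norm] at hn ⊢
  linarith

/-- The ultrapower `A_ω`: bounded sequences in `A`, modulo those that tend to `0` in norm
along `ω`. -/
def Ultrapower : Type _ := (ℕ →ᵇ A) ⧸ nullIdeal A ω

namespace Ultrapower

instance : Ring (Ultrapower A ω) := inferInstanceAs (Ring ((ℕ →ᵇ A) ⧸ nullIdeal A ω))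

instance : Algebra ℂ (Ultrapower A ω) := inferInstanceAs (Algebra ℂ ((ℕ →ᵇ A) ⧸ nullIdeal A ω))

/-- The class in `A_ω` of a bounded sequence. -/
def mk : (ℕ →ᵇ A) →ₐ[ℂ] Ultrapower A ω := Ideal.Quotient.mkₐ ℂ (nullIdeal A ω)

variable {A}

theorem mk_surjective : Function.Surjective (mk A ω) := Ideal.Quotient.mk_surjective

theorem mk_eq_mk {a b : ℕ →ᵇ A} : mk A ω a = mk A ω b ↔ a - b ∈ nullIdeal A ω := Ideal.Quotient.eq

instance : Star (Ultrapower A ω) where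
  star := Quotient.lift (fun a => mk A ω (star a)) fun a b hab => by
    have h : a - b ∈ nullIdeal A ω := (Submodule.quotientRel_def _).1 hab
    refine (mk_eq_mk ω).2 ?_
    rw [← star_sub]
    exact star_mem_nullIdeal ω h

theorem star_mk (a : ℕ →ᵇ A) : star (mk A ω a) = mk A ω (star a) := rfl

instance : StarRing (Ultrapower A ω) where
  star_involutive x := by
    obtain ⟨a, rfl⟩ := mk_surjective ω x
    simp [star_mk]
  star_mul x y := by
    obtain ⟨a, rfl⟩ := mk_surjective ω x
    obtain ⟨b, rfl⟩ := mk_surjective ω y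
    simp [← map_mul, star_mk]
  star_add x y := by
    obtain ⟨a, rfl⟩ := mk_surjective ω x
    obtain ⟨b, rfl⟩ := mk_surjective ω y
    simp [← map_add, star_mk]

instance : StarModule ℂ (Ultrapower A ω) where
  star_smul c x := by
    obtain ⟨a, rfl⟩ := mk_surjective ω x
    simp [← map_smul, star_mk]

/-- `A_ω` carries the quotient norm; by `tendsto_norm` this is `lim_{n → ω} ‖aₙ‖`. -/
instance : NormedAddCommGroup (Ultrapower A ω) :=
  inferInstanceAs (NormedAddCommGroup ((ℕ →ᵇ A) ⧸ nullIdeal A ω))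

instance : CompleteSpace (Ultrapower A ω) :=
  inferInstanceAs (CompleteSpace ((ℕ →ᵇ A) ⧸ nullIdeal A ω))

theorem norm_mk_le (a : ℕ →ᵇ A) : ‖mk A ω a‖ ≤ ‖a‖ :=
  Submodule.Quotient.norm_mk_le (nullIdeal A ω) a

theorem exists_norm_lt (x : Ultrapower A ω) {r : ℝ} (h : ‖x‖ < r) :
    ∃ a : ℕ →ᵇ A, mk A ω a = x ∧ ‖a‖ < r := by
  obtain ⟨a, ha, h'⟩ := Submodule.Quotient.norm_mk_lt (S := nullIdeal A ω) x (sub_pos.2 h)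
  refine ⟨a, ha, h'.trans_le ?_⟩
  exact le_of_eq (add_sub_cancel _ _)

/-- The norm of the class of a bounded sequence `(aₙ)` is `lim_{n → ω} ‖aₙ‖`. -/
theorem tendsto_norm (a : ℕ →ᵇ A) :
    Filter.Tendsto (fun n => ‖a n‖) ω (nhds ‖mk A ω a‖) := by
  rw [Metric.tendsto_nhds]
  intro ε hε
  have hup : ∀ᶠ n in (ω : Filter ℕ), ‖a n‖ < ‖mk A ω a‖ + ε := by
    obtain ⟨b, hb, hlt⟩ := exists_norm_lt ω (mk A ω a) (lt_add_of_pos_right _ (half_pos hε))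
    have h0 := (mem_nullIdeal ω).1 ((mk_eq_mk ω).1 hb)
    filter_upwards [Metric.tendsto_nhds.1 h0 (ε / 2) (half_pos hε)] with n hn
    have h1 : ‖b n - a n‖ < ε / 2 := by simpa using hn
    have h2 : ‖a n‖ ≤ ‖b n - a n‖ + ‖b n‖ := by
      rw [norm_sub_rev]; simpa using norm_add_le (a n - b n) (b n)
    linarith [b.norm_coe_le_norm n]
  have hlo : ∀ᶠ n in (ω : Filter ℕ), ‖mk A ω a‖ - ε < ‖a n‖ := by
    by_contra hcon
    have hle : ∀ᶠ n in (ω : Filter ℕ), ‖a n‖ ≤ ‖mk A ω a‖ - ε := by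
      simpa using Ultrafilter.eventually_not.2 hcon
    have hr : 0 ≤ ‖mk A ω a‖ - ε := by
      obtain ⟨n, hn⟩ := hle.exists
      exact (norm_nonneg _).trans hn
    obtain ⟨b, hb, hab⟩ := exists_sub_mem_nullIdeal ω a hr hle
    have := norm_mk_le ω b
    rw [← (mk_eq_mk ω).2 hab] at this
    linarith
  filter_upwards [hup, hlo] with n h1 h2
  rw [Real.dist_eq, abs_lt]
  constructor <;> linarith

instance : NormedRing (Ultrapower A ω) where
  __ := (inferInstance : Ring (Ultrapower A ω))
  __ := (inferInstance : NormedAddCommGroup (Ultrapower A ω))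
  norm_mul_le x y := by
    obtain ⟨a, rfl⟩ := mk_surjective ω x
    obtain ⟨b, rfl⟩ := mk_surjective ω y
    rw [← map_mul]
    exact le_of_tendsto_of_tendsto' (tendsto_norm ω _)
      ((tendsto_norm ω a).mul (tendsto_norm ω b)) fun n => norm_mul_le (a n) (b n)

instance : NormedAlgebra ℂ (Ultrapower A ω) where
  norm_smul_le c x := by
    obtain ⟨a, rfl⟩ := mk_surjective ω x
    rw [← map_smul]
    exact le_of_tendsto_of_tendsto' (tendsto_norm ω _)
      ((tendsto_norm ω a).const_mul ‖c‖) fun n => norm_smul_le c (a n)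

instance : CStarRing (Ultrapower A ω) where
  norm_mul_self_le x := by
    obtain ⟨a, rfl⟩ := mk_surjective ω x
    rw [star_mk, ← map_mul]
    exact le_of_tendsto_of_tendsto' ((tendsto_norm ω a).mul (tendsto_norm ω a))
      (tendsto_norm ω _) fun n => (CStarRing.norm_star_mul_self (x := a n)).ge

instance : CStarAlgebra (Ultrapower A ω) where

end Ultrapower

end Ultrapower

/-! ### Tracial states and the uniform 2-norm -/

section Trace

variable (A : Type*) [CStarAlgebra A]

/-- The trace space `T(A)`: all tracial states on `A`. -/
def traceSpace : Set (A →ₗ[ℂ] ℂ) :=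
  {τ | τ 1 = 1 ∧ (∀ a, 0 ≤ τ (star a * a)) ∧ ∀ a b, τ (a * b) = τ (b * a)}

variable {A}

/-- The uniform 2-norm `‖a‖₂ = sup_{τ ∈ T(A)} τ(a* a)^{1/2}`. -/
def twoNorm (a : A) : ℝ := ⨆ τ : traceSpace A, √(τ.1 (star a * a)).re

theorem traceNorm_add_le {τ : A →ₗ[ℂ] ℂ} (hτ : τ ∈ traceSpace A) (a b : A) :
    √(τ (star (a + b) * (a + b))).re ≤ √(τ (star a * a)).re + √(τ (star b * b)).re := by
  let _ := CStarAlgebra.spectralOrder A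
  have _ := CStarAlgebra.spectralOrderedRing A
  let f : A →ₚ[ℂ] ℂ := PositiveLinearMap.mk₀ τ fun x hx => by
    obtain ⟨c, rfl⟩ := CStarAlgebra.nonneg_iff_eq_star_mul_self.1 hx
    exact hτ.2.1 c
  exact norm_add_le (f.toPreGNS a) (f.toPreGNS b)

theorem traceNorm_mul_le {τ : A →ₗ[ℂ] ℂ} (hτ : τ ∈ traceSpace A) (a b : A) :
    √(τ (star (a * b) * (a * b))).re ≤ ‖a‖ * √(τ (star b * b)).re := by
  let _ := CStarAlgebra.spectralOrder A
  have _ := CStarAlgebra.spectralOrderedRing A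
  have h : star b * (star a * a) * b ≤ ‖star a * a‖ • (star b * b) :=
    CStarAlgebra.star_left_conjugate_le_norm_smul
  rw [← sub_nonneg, CStarAlgebra.nonneg_iff_eq_star_mul_self] at h
  obtain ⟨c, hc⟩ := h
  have h := (Complex.nonneg_iff.1 (hτ.2.1 c)).1
  rw [← hc, map_sub, Complex.sub_re, CStarRing.norm_star_mul_self, ← sq, ← Complex.coe_smul,
    map_smul, smul_eq_mul, Complex.re_ofReal_mul, sub_nonneg] at h
  rw [← Real.sqrt_sq (norm_nonneg a), ← Real.sqrt_mul (sq_nonneg _)]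
  refine Real.sqrt_le_sqrt ?_
  simpa only [star_mul, mul_assoc] using h

theorem traceNorm_le_norm {τ : A →ₗ[ℂ] ℂ} (hτ : τ ∈ traceSpace A) (a : A) :
    √(τ (star a * a)).re ≤ ‖a‖ := by
  simpa [hτ.1] using traceNorm_mul_le hτ a 1

theorem bddAbove_traceNorm (a : A) :
    BddAbove (Set.range fun τ : traceSpace A => √(τ.1 (star a * a)).re) :=
  ⟨‖a‖, by rintro _ ⟨τ, rfl⟩; exact traceNorm_le_norm τ.2 a⟩

theorem twoNorm_nonneg (a : A) : 0 ≤ twoNorm a := Real.iSup_nonneg fun _ => Real.sqrt_nonneg _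

theorem twoNorm_le_norm (a : A) : twoNorm a ≤ ‖a‖ :=
  Real.iSup_le (fun τ => traceNorm_le_norm τ.2 a) (norm_nonneg a)

theorem twoNorm_add_le (a b : A) : twoNorm (a + b) ≤ twoNorm a + twoNorm b :=
  Real.iSup_le (fun τ => (traceNorm_add_le τ.2 a b).trans
    (add_le_add (le_ciSup (bddAbove_traceNorm a) τ) (le_ciSup (bddAbove_traceNorm b) τ)))
    (add_nonneg (twoNorm_nonneg a) (twoNorm_nonneg b))

theorem twoNorm_neg (a : A) : twoNorm (-a) = twoNorm a := by simp [twoNorm]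

theorem twoNorm_star (a : A) : twoNorm (star a) = twoNorm a := by
  refine iSup_congr fun τ => ?_
  rw [star_star, τ.2.2.2]

theorem twoNorm_mul_le (a b : A) : twoNorm (a * b) ≤ ‖a‖ * twoNorm b :=
  Real.iSup_le (fun τ => (traceNorm_mul_le τ.2 a b).trans
    (mul_le_mul_of_nonneg_left (le_ciSup (bddAbove_traceNorm b) τ) (norm_nonneg a)))
    (mul_nonneg (norm_nonneg a) (twoNorm_nonneg b))

theorem twoNorm_mul_le' (a b : A) : twoNorm (a * b) ≤ twoNorm a * ‖b‖ := by
  rw [← twoNorm_star, star_mul, mul_comm (twoNorm a), ← norm_star b, ← twoNorm_star a]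
  exact twoNorm_mul_le _ _

theorem abs_twoNorm_sub_le (a b : A) : |twoNorm a - twoNorm b| ≤ ‖a - b‖ := by
  have h1 := twoNorm_add_le (a - b) b
  have h2 := twoNorm_add_le (-(a - b)) a
  rw [twoNorm_neg] at h2
  rw [show -(a - b) + a = b by abel] at h2
  rw [sub_add_cancel] at h1
  have := twoNorm_le_norm (a - b)
  rw [abs_le]
  constructor <;> linarith

end Trace

/-! ### The trace-kernel ideal -/

section TraceKernelIdeal

variable {A : Type*} [CStarAlgebra A] (ω : Ultrafilter ℕ)

/-- The limit along `ω` of the uniform 2-norms of the terms of a bounded sequence exists. -/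
theorem tendsto_twoNorm (a : ℕ →ᵇ A) :
    Filter.Tendsto (fun n => twoNorm (a n)) ω
      (nhds (Filter.limUnder (ω : Filter ℕ) fun n => twoNorm (a n))) := by
  have hmem : ∀ n, twoNorm (a n) ∈ Set.Icc 0 ‖a‖ := fun n =>
    ⟨twoNorm_nonneg _, (twoNorm_le_norm _).trans (a.norm_coe_le_norm n)⟩
  obtain ⟨x, -, hx⟩ := isCompact_Icc.ultrafilter_le_nhds (ω.map fun n => twoNorm (a n))
    (Filter.le_principal_iff.2 (Filter.univ_mem' (f := (ω : Filter ℕ)) hmem))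
  exact tendsto_nhds_limUnder ⟨x, hx⟩

/-- The seminorm `‖a‖_{2,ω} = lim_{n → ω} sup_{τ ∈ T(A)} τ(aₙ* aₙ)^{1/2}` on `A_ω`, where `(aₙ)` is
any bounded sequence that represents `a`. -/
def ultraTwoNorm (x : Ultrapower A ω) : ℝ :=
  Quotient.lift (fun a : ℕ →ᵇ A => Filter.limUnder (ω : Filter ℕ) fun n => twoNorm (a n))
    (fun a b hab => by
      have h : a - b ∈ nullIdeal A ω := (Submodule.quotientRel_def _).1 hab
      refine sub_eq_zero.1 (tendsto_nhds_unique ((tendsto_twoNorm ω a).sub (tendsto_twoNorm ω b)) ?_)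
      exact squeeze_zero_norm (fun n => abs_twoNorm_sub_le (a n) (b n)) ((mem_nullIdeal ω).1 h)) x

theorem tendsto_ultraTwoNorm (a : ℕ →ᵇ A) :
    Filter.Tendsto (fun n => twoNorm (a n)) ω (nhds (ultraTwoNorm ω (Ultrapower.mk A ω a))) :=
  tendsto_twoNorm ω a

variable (A) in
/-- The trace-kernel ideal `J_A = {e ∈ A_ω : ‖e‖_{2,ω} = 0}`. -/
def traceKernelIdeal : TwoSidedIdeal (Ultrapower A ω) :=
  TwoSidedIdeal.mk' {e | ultraTwoNorm ω e = 0}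
    (by
      have h := tendsto_ultraTwoNorm ω (0 : ℕ →ᵇ A)
      rw [map_zero] at h
      refine tendsto_nhds_unique h ?_
      simp [twoNorm])
    (by
      intro x y hx hy
      obtain ⟨a, rfl⟩ := Ultrapower.mk_surjective ω x
      obtain ⟨b, rfl⟩ := Ultrapower.mk_surjective ω y
      have ha := tendsto_ultraTwoNorm ω a
      have hb := tendsto_ultraTwoNorm ω b
      rw [Set.mem_ofPred_eq] at hx hy
      rw [hx] at ha
      rw [hy] at hb
      rw [← map_add]
      refine tendsto_nhds_unique (tendsto_ultraTwoNorm ω (a + b)) ?_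
      exact squeeze_zero (fun n => twoNorm_nonneg _) (fun n => twoNorm_add_le (a n) (b n))
        (by simpa using ha.add hb))
    (by
      intro x hx
      obtain ⟨a, rfl⟩ := Ultrapower.mk_surjective ω x
      have ha := tendsto_ultraTwoNorm ω a
      rw [Set.mem_ofPred_eq] at hx
      rw [hx] at ha
      rw [← map_neg]
      refine tendsto_nhds_unique (tendsto_ultraTwoNorm ω (-a)) ?_
      simpa [twoNorm_neg] using ha)
    (by
      intro x y hy
      obtain ⟨a, rfl⟩ := Ultrapower.mk_surjective ω x
      obtain ⟨b, rfl⟩ := Ultrapower.mk_surjective ω y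
      have hb := tendsto_ultraTwoNorm ω b
      rw [Set.mem_ofPred_eq] at hy
      rw [hy] at hb
      rw [← map_mul]
      refine tendsto_nhds_unique (tendsto_ultraTwoNorm ω (a * b)) ?_
      exact squeeze_zero (fun n => twoNorm_nonneg _) (fun n => (twoNorm_mul_le (a n) (b n)).trans
        (mul_le_mul_of_nonneg_right (a.norm_coe_le_norm n) (twoNorm_nonneg _)))
        (by simpa using hb.const_mul ‖a‖))
    (by
      intro x y hx
      obtain ⟨a, rfl⟩ := Ultrapower.mk_surjective ω x
      obtain ⟨b, rfl⟩ := Ultrapower.mk_surjective ω y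
      have ha := tendsto_ultraTwoNorm ω a
      rw [Set.mem_ofPred_eq] at hx
      rw [hx] at ha
      rw [← map_mul]
      refine tendsto_nhds_unique (tendsto_ultraTwoNorm ω (a * b)) ?_
      exact squeeze_zero (fun n => twoNorm_nonneg _) (fun n => (twoNorm_mul_le' (a n) (b n)).trans
        (mul_le_mul_of_nonneg_left (b.norm_coe_le_norm n) (twoNorm_nonneg _)))
        (by simpa using ha.mul_const ‖b‖))

theorem mem_traceKernelIdeal {x : Ultrapower A ω} :
    x ∈ traceKernelIdeal A ω ↔ ultraTwoNorm ω x = 0 :=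
  TwoSidedIdeal.mem_mk' _ _ _ _ _ _ _

end TraceKernelIdeal

/-! ### Actions -/

section Action

variable {A : Type*} [CStarAlgebra A] (ω : Ultrafilter ℕ)

/-- The sequence `(φ(aₙ))`. -/
def mapSeq (φ : A ≃⋆ₐ[ℂ] A) (a : ℕ →ᵇ A) : ℕ →ᵇ A :=
  BoundedContinuousFunction.ofNormedAddCommGroupDiscrete (fun n => φ (a n)) ‖a‖ fun n => by
    rw [NonUnitalStarAlgHom.norm_map φ φ.injective]
    exact a.norm_coe_le_norm n

theorem mapSeq_apply (φ : A ≃⋆ₐ[ℂ] A) (a : ℕ →ᵇ A) (n : ℕ) : mapSeq φ a n = φ (a n) := rfl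

theorem mapSeq_sub_mem {φ : A ≃⋆ₐ[ℂ] A} {a b : ℕ →ᵇ A} (h : a - b ∈ nullIdeal A ω) :
    mapSeq φ a - mapSeq φ b ∈ nullIdeal A ω := by
  rw [mem_nullIdeal] at h ⊢
  simpa [mapSeq_apply, ← map_sub, NonUnitalStarAlgHom.norm_map φ φ.injective] using h

/-- The map `[(aₙ)] ↦ [(φ(aₙ))]` on `A_ω`. -/
def ultraMapFun (φ : A ≃⋆ₐ[ℂ] A) (x : Ultrapower A ω) : Ultrapower A ω :=
  Quotient.lift (fun a => Ultrapower.mk A ω (mapSeq φ a))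
    (fun _ _ hab => (Ultrapower.mk_eq_mk ω).2
      (mapSeq_sub_mem ω ((Submodule.quotientRel_def _).1 hab))) x

theorem ultraMapFun_mk (φ : A ≃⋆ₐ[ℂ] A) (a : ℕ →ᵇ A) :
    ultraMapFun ω φ (Ultrapower.mk A ω a) = Ultrapower.mk A ω (mapSeq φ a) := rfl

/-- The automorphism `[(aₙ)] ↦ [(φ(aₙ))]` of `A_ω` induced by an automorphism `φ` of `A`. -/
def ultraMap (φ : A ≃⋆ₐ[ℂ] A) : Ultrapower A ω ≃⋆ₐ[ℂ] Ultrapower A ω where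
  toFun := ultraMapFun ω φ
  invFun := ultraMapFun ω φ.symm
  left_inv x := by
    obtain ⟨a, rfl⟩ := Ultrapower.mk_surjective ω x
    rw [ultraMapFun_mk, ultraMapFun_mk]
    congr 1
    ext n
    simp [mapSeq_apply]
  right_inv x := by
    obtain ⟨a, rfl⟩ := Ultrapower.mk_surjective ω x
    rw [ultraMapFun_mk, ultraMapFun_mk]
    congr 1
    ext n
    simp [mapSeq_apply]
  map_mul' x y := by
    obtain ⟨a, rfl⟩ := Ultrapower.mk_surjective ω x
    obtain ⟨b, rfl⟩ := Ultrapower.mk_surjective ω y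
    rw [← map_mul, ultraMapFun_mk, ultraMapFun_mk, ultraMapFun_mk, ← map_mul]
    congr 1
    ext n
    simp [mapSeq_apply]
  map_add' x y := by
    obtain ⟨a, rfl⟩ := Ultrapower.mk_surjective ω x
    obtain ⟨b, rfl⟩ := Ultrapower.mk_surjective ω y
    rw [← map_add, ultraMapFun_mk, ultraMapFun_mk, ultraMapFun_mk, ← map_add]
    congr 1
    ext n
    simp [mapSeq_apply]
  map_star' x := by
    obtain ⟨a, rfl⟩ := Ultrapower.mk_surjective ω x
    rw [Ultrapower.star_mk, ultraMapFun_mk, ultraMapFun_mk, Ultrapower.star_mk]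
    congr 1
    ext n
    simp [mapSeq_apply, map_star]
  map_smul' c x := by
    obtain ⟨a, rfl⟩ := Ultrapower.mk_surjective ω x
    rw [← map_smul, ultraMapFun_mk, ultraMapFun_mk, ← map_smul]
    congr 1
    ext n
    simp [mapSeq_apply]

theorem ultraMap_mk (φ : A ≃⋆ₐ[ℂ] A) (a : ℕ →ᵇ A) :
    ultraMap ω φ (Ultrapower.mk A ω a) = Ultrapower.mk A ω (mapSeq φ a) := rfl

/-- The action `α_ω` on `A_ω` induced by an action `α` on `A`:
`(α_ω)^g [(aₙ)] = [(α^g(aₙ))]`. -/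
def ultraAction {Γ : Type*} [Group Γ] (α : Γ →* (A ≃⋆ₐ[ℂ] A)) :
    Γ →* (Ultrapower A ω ≃⋆ₐ[ℂ] Ultrapower A ω) where
  toFun g := ultraMap ω (α g)
  map_one' := by
    ext x
    obtain ⟨a, rfl⟩ := Ultrapower.mk_surjective ω x
    rw [ultraMap_mk, StarAlgEquiv.one_apply]
    congr 1
    ext n
    simp [mapSeq_apply]
  map_mul' g h := by
    ext x
    obtain ⟨a, rfl⟩ := Ultrapower.mk_surjective ω x
    rw [StarAlgEquiv.mul_apply, ultraMap_mk, ultraMap_mk, ultraMap_mk]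
    congr 1
    ext n
    simp [mapSeq_apply]

/-- Amenability of a discrete group: for every finite `F ⊆ Γ` and every `ε > 0` there is an
`(F, ε)`-invariant nonempty finite set `K ⊆ Γ`, i.e. `|sK ∆ K| / |K| < ε` for all `s ∈ F`. -/
def IsAmenable (Γ : Type*) [Group Γ] : Prop :=
  ∀ (F : Finset Γ) (ε : ℝ), 0 < ε → ∃ K : Finset Γ, K.Nonempty ∧
    ∀ s ∈ F, ((symmDiff ((fun k => s * k) '' (K : Set Γ)) (K : Set Γ)).ncard : ℝ) / K.card < ε

/-- `J` is an `α`-`σ`-ideal of the C⋆-algebra `B`: it is a closed two-sided ideal, it is invariant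
under `α`, and for every separable `α`-invariant C⋆-subalgebra `C` of `B` there is a positive
contraction `u ∈ C' ∩ J` that is fixed by `α` and satisfies `u c = c` for all `c ∈ C ∩ J`. -/
structure IsSigmaIdeal {B : Type*} [NonUnitalCStarAlgebra B] {Γ : Type*} [Group Γ]
    (α : Γ →* (B ≃⋆ₐ[ℂ] B)) (J : TwoSidedIdeal B) : Prop where
  isClosed : IsClosed (J : Set B)
  invariant : ∀ g, α g '' (J : Set B) = J
  exists_unit : ∀ C : NonUnitalStarSubalgebra ℂ B, IsClosed (C : Set B) →
    TopologicalSpace.IsSeparable (C : Set B) → (∀ g, α g '' (C : Set B) = C) →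
    ∃ u ∈ J, (∃ b, u = star b * b) ∧ ‖u‖ ≤ 1 ∧ (∀ c ∈ C, u * c = c * u) ∧
      (∀ g, α g u = u) ∧ ∀ c ∈ C, c ∈ J → u * c = c

end Action

end TraceKernel

end

noncomputable section

namespace TraceKernel

/-! The ideal $J_A$ is closed because $\|\cdot\|_{2,\omega}$ is a seminorm dominated by the norm,
and invariant because composing a tracial state with an automorphism gives a tracial state. The
substance is the unit $u$.

Since $\omega$ is free, a diagonal argument turns approximate solutions in $J_A$ of countably many
relations into exact ones (`exists_mem_kernelContractions_of_approx`). Applied to an approximate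
unit of $J_A$, it shows that every countable subset of $J_A$ has an exact unit in $J_A$
(`exists_exact_unit`).

Hence there are positive contractions $e_0, e_1, \dots$ in $J_A$, all units for a given countable $S
\subseteq J_A$, such that $e_j$ is also a unit for $e_i$ and for the elements $ce_i$, $c^*e_i$,
$c^*ce_i$, $\varphi^{\pm1}(e_i)$ whenever $i < j$ (`exists_seq_exact_units`). The defects $f_i =
e_ic - ce_i$, and likewise $f_i = \varphi(e_i) - e_i$, then satisfy $f_j^*f_i = 0$ for $i < j$. By
the $C^*$-identity a sum of $N$ such uniformly bounded elements has norm $O(\sqrt N)$, so the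
average of $e_0, \dots, e_{N-1}$ almost commutes with each $c$ and is almost fixed by each
$\varphi$, while it is still a unit for $S$. A second diagonal argument makes these relations exact
(`exists_quasicentral_exact_unit`). Taking dense sequences in $C$ and in $C \cap J_A$, and all
automorphisms of the action, gives $u$. -/

/-- Kirchberg's `ε`-test: a diagonal argument along a free ultrafilter. -/
theorem exists_seq_of_eventually_exists {X : Type*} (ω : Ultrafilter ℕ)
    (hω : (ω : Filter ℕ) ≤ Filter.cofinite) (φ : ℕ → ℕ → X → ℝ)
    (h : ∀ m : ℕ, ∀ᶠ n in (ω : Filter ℕ), ∃ x, ∀ i < m, φ i n x < 1 / ((m : ℝ) + 1)) :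
    ∃ x : ℕ → X, ∀ i, ∀ ε > 0, ∀ᶠ n in (ω : Filter ℕ), φ i n (x n) < ε := by
  classical
  have hX : Nonempty X := by
    obtain ⟨n, x, -⟩ := (h 0).exists
    exact ⟨x⟩
  -- At index `n` the point `x n` solves the first `m` conditions for the largest possible `m ≤ n`.
  -- As `ω` is free, the cap `m ≤ n` eventually excludes no fixed `m`.
  let Q : ℕ → ℕ → Prop := fun n m => ∃ x, ∀ i < m, φ i n x < 1 / ((m : ℝ) + 1)
  have hQ0 : ∀ n, Q n 0 := fun n => ⟨hX.some, fun i hi => absurd hi (Nat.not_lt_zero i)⟩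
  have hQ : ∀ n, Q n (Nat.findGreatest (Q n) n) := fun n =>
    Nat.findGreatest_spec (Nat.zero_le n) (hQ0 n)
  choose x hx using hQ
  refine ⟨x, fun i ε hε => ?_⟩
  obtain ⟨m, hm⟩ := exists_nat_one_div_lt hε
  have hge : ∀ᶠ n in (ω : Filter ℕ), max m (i + 1) ≤ n :=
    (Nat.cofinite_eq_atTop ▸ hω) (Filter.eventually_ge_atTop _)
  -- In the maximum, `m` secures the tolerance `ε` and `i + 1` places condition `i` among those
  -- solved.
  filter_upwards [hge, h (max m (i + 1))] with n hn hq
  have hk : max m (i + 1) ≤ Nat.findGreatest (Q n) n := Nat.le_findGreatest hn hq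
  refine (hx n i (by omega)).trans (lt_of_le_of_lt ?_ hm)
  have : (m : ℝ) ≤ (Nat.findGreatest (Q n) n : ℕ) := by exact_mod_cast (le_max_left _ _).trans hk
  exact one_div_le_one_div_of_le (by positivity) (by linarith)

/-! ### The trace-kernel ideal and exact solutions in the ultrapower -/

section Ultrapower

variable {A : Type*} [CStarAlgebra A] (ω : Ultrafilter ℕ)

theorem eventually_norm_lt {a : ℕ →ᵇ A} {r : ℝ} (h : ‖Ultrapower.mk A ω a‖ < r) :
    ∀ᶠ n in (ω : Filter ℕ), ‖a n‖ < r :=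
  (Ultrapower.tendsto_norm ω a).eventually_lt_const h

theorem mk_eq_mk_of_forall_eventually {a b : ℕ →ᵇ A}
    (h : ∀ ε > 0, ∀ᶠ n in (ω : Filter ℕ), ‖a n - b n‖ < ε) :
    Ultrapower.mk A ω a = Ultrapower.mk A ω b := by
  rw [Ultrapower.mk_eq_mk, mem_nullIdeal, Metric.tendsto_nhds]
  intro ε hε
  filter_upwards [h ε hε] with n hn
  simpa using hn

theorem ultraTwoNorm_le_norm (x : Ultrapower A ω) : ultraTwoNorm ω x ≤ ‖x‖ := by
  obtain ⟨a, rfl⟩ := Ultrapower.mk_surjective ω x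
  exact le_of_tendsto_of_tendsto' (tendsto_ultraTwoNorm ω a) (Ultrapower.tendsto_norm ω a)
    fun n => twoNorm_le_norm (a n)

theorem ultraTwoNorm_nonneg (x : Ultrapower A ω) : 0 ≤ ultraTwoNorm ω x := by
  obtain ⟨a, rfl⟩ := Ultrapower.mk_surjective ω x
  exact ge_of_tendsto' (tendsto_ultraTwoNorm ω a) fun n => twoNorm_nonneg (a n)

theorem ultraTwoNorm_add_le (x y : Ultrapower A ω) :
    ultraTwoNorm ω (x + y) ≤ ultraTwoNorm ω x + ultraTwoNorm ω y := by
  obtain ⟨a, rfl⟩ := Ultrapower.mk_surjective ω x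
  obtain ⟨b, rfl⟩ := Ultrapower.mk_surjective ω y
  rw [← map_add]
  exact le_of_tendsto_of_tendsto' (tendsto_ultraTwoNorm ω _)
    ((tendsto_ultraTwoNorm ω a).add (tendsto_ultraTwoNorm ω b))
    fun n => twoNorm_add_le (a n) (b n)

theorem ultraTwoNorm_star (x : Ultrapower A ω) : ultraTwoNorm ω (star x) = ultraTwoNorm ω x := by
  obtain ⟨a, rfl⟩ := Ultrapower.mk_surjective ω x
  refine tendsto_nhds_unique (tendsto_ultraTwoNorm ω (star a)) ?_
  simpa [twoNorm_star] using tendsto_ultraTwoNorm ω a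

theorem star_mem_traceKernelIdeal {x : Ultrapower A ω} (hx : x ∈ traceKernelIdeal A ω) :
    star x ∈ traceKernelIdeal A ω := by
  rw [mem_traceKernelIdeal] at hx ⊢
  rw [ultraTwoNorm_star, hx]

theorem isClosed_traceKernelIdeal : IsClosed (traceKernelIdeal A ω : Set (Ultrapower A ω)) := by
  refine isClosed_of_closure_subset fun x hx => ?_
  change x ∈ traceKernelIdeal A ω
  rw [mem_traceKernelIdeal]
  refine le_antisymm (le_of_forall_pos_le_add fun ε hε => ?_) (ultraTwoNorm_nonneg ω x)
  obtain ⟨y, hy, hxy⟩ := Metric.mem_closure_iff.1 hx ε hε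
  have hy' : ultraTwoNorm ω y = 0 := (mem_traceKernelIdeal ω).1 hy
  have h1 := ultraTwoNorm_add_le ω (x - y) y
  have h2 := ultraTwoNorm_le_norm ω (x - y)
  rw [sub_add_cancel] at h1
  rw [dist_eq_norm] at hxy
  linarith

/-- Precomposition with `φ` maps tracial states to tracial states, so the supremum on the left runs
over part of the family on the right. -/
theorem twoNorm_map_le (φ : A ≃⋆ₐ[ℂ] A) (a : A) : twoNorm (φ a) ≤ twoNorm a := by
  refine Real.iSup_le (fun τ => ?_) (twoNorm_nonneg a)
  let σ : A →ₗ[ℂ] ℂ := τ.1.comp (φ.toAlgEquiv.toLinearMap)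
  have hσ : ∀ x, σ x = τ.1 (φ x) := fun _ => rfl
  have hmem : σ ∈ traceSpace A := by
    refine ⟨?_, fun x => ?_, fun x y => ?_⟩
    · rw [hσ, map_one, τ.2.1]
    · rw [hσ, map_mul, map_star]
      exact τ.2.2.1 _
    · rw [hσ, hσ, map_mul φ, map_mul φ]
      exact τ.2.2.2 _ _
  have := le_ciSup (bddAbove_traceNorm a) ⟨σ, hmem⟩
  simpa [hσ, map_star, twoNorm] using this

theorem ultraMap_mem_traceKernelIdeal (φ : A ≃⋆ₐ[ℂ] A) {x : Ultrapower A ω}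
    (hx : x ∈ traceKernelIdeal A ω) : ultraMap ω φ x ∈ traceKernelIdeal A ω := by
  rw [mem_traceKernelIdeal] at hx ⊢
  obtain ⟨a, rfl⟩ := Ultrapower.mk_surjective ω x
  refine le_antisymm ?_ (ultraTwoNorm_nonneg ω _)
  rw [← hx, ultraMap_mk]
  exact le_of_tendsto_of_tendsto' (tendsto_ultraTwoNorm ω _) (tendsto_ultraTwoNorm ω a)
    fun n => twoNorm_map_le φ (a n)

theorem image_traceKernelIdeal {Γ : Type*} [Group Γ] (α : Γ →* (A ≃⋆ₐ[ℂ] A)) (g : Γ) :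
    ultraAction ω α g '' (traceKernelIdeal A ω : Set (Ultrapower A ω)) =
      traceKernelIdeal A ω := by
  refine Set.Subset.antisymm ?_ fun x hx => ?_
  · rintro _ ⟨x, hx, rfl⟩
    exact ultraMap_mem_traceKernelIdeal ω (α g) hx
  · refine ⟨ultraAction ω α g⁻¹ x, ultraMap_mem_traceKernelIdeal ω (α g⁻¹) hx, ?_⟩
    rw [← StarAlgEquiv.mul_apply, ← map_mul, mul_inv_cancel, map_one, StarAlgEquiv.one_apply]

variable (A) in
/-- The positive contractions in the trace-kernel ideal. -/
def kernelContractions : Set (Ultrapower A ω) :=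
  {u | u ∈ traceKernelIdeal A ω ∧ ∃ b, ‖b‖ ≤ 1 ∧ u = star b * b}

/-- Countably many relations that positive contractions in `J_A` satisfy approximately are
satisfied exactly by some positive contraction in `J_A`. -/
theorem exists_mem_kernelContractions_of_approx (hω : (ω : Filter ℕ) ≤ Filter.cofinite)
    (s c : ℕ → Ultrapower A ω) (φ : ℕ → (A ≃⋆ₐ[ℂ] A))
    (h : ∀ m : ℕ, ∀ ε > 0, ∃ u ∈ kernelContractions A ω, ∀ i < m, ‖u * s i - s i‖ < ε ∧
      ‖u * c i - c i * u‖ < ε ∧ ‖ultraMap ω (φ i) u - u‖ < ε) :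
    ∃ u ∈ kernelContractions A ω, ∀ i, u * s i = s i ∧ u * c i = c i * u ∧
      ultraMap ω (φ i) u = u := by
  choose S hS using fun i => Ultrapower.mk_surjective ω (s i)
  choose C hC using fun i => Ultrapower.mk_surjective ω (c i)
  -- The unknown is the factor `b` rather than `u = star b * b`, so positivity survives passage to
  -- representing sequences. The bound 2 keeps these sequences bounded and leaves room for lifting,
  -- since a contraction need only lift to norm `< 2`; the term `‖b‖ - 1` restores norm at most 1 in
  -- the limit.
  let ψ : ℕ → ℕ → {b : A // ‖b‖ ≤ 2} → ℝ := fun i n b =>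
    max (‖b.1‖ - 1) <| max (twoNorm (star b.1 * b.1)) <|
    max ‖star b.1 * b.1 * S i n - S i n‖ <|
    max ‖star b.1 * b.1 * C i n - C i n * (star b.1 * b.1)‖ ‖φ i (star b.1 * b.1) - star b.1 * b.1‖
  have key := exists_seq_of_eventually_exists ω hω ψ ?_
  · obtain ⟨x, hx⟩ := key
    let b : ℕ →ᵇ A := BoundedContinuousFunction.ofNormedAddCommGroupDiscrete
      (fun n => (x n).1) 2 fun n => (x n).2
    have hb : ∀ n, b n = (x n).1 := fun _ => rfl
    simp only [ψ, max_lt_iff, ← hb] at hx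
    refine ⟨Ultrapower.mk A ω (star b * b), ⟨?_, Ultrapower.mk A ω b, ?_, ?_⟩, fun i => ⟨?_, ?_, ?_⟩⟩
    · rw [mem_traceKernelIdeal]
      refine le_antisymm (le_of_forall_pos_le_add fun ε hε => ?_) (ultraTwoNorm_nonneg ω _)
      refine le_of_tendsto (tendsto_ultraTwoNorm ω _) ?_
      -- The first two terms of `ψ` do not depend on `i`, so index 0 serves.
      filter_upwards [hx 0 ε hε] with n hn
      simpa using hn.2.1.le
    · refine le_of_forall_pos_le_add fun ε hε => le_of_tendsto (Ultrapower.tendsto_norm ω b) ?_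
      filter_upwards [hx 0 ε hε] with n hn
      linarith [hn.1]
    · rw [map_mul, Ultrapower.star_mk]
    · rw [← hS, ← map_mul]
      refine mk_eq_mk_of_forall_eventually ω fun ε hε => ?_
      filter_upwards [hx i ε hε] with n hn
      exact hn.2.2.1
    · rw [← hC, ← map_mul, ← map_mul]
      refine mk_eq_mk_of_forall_eventually ω fun ε hε => ?_
      filter_upwards [hx i ε hε] with n hn
      exact hn.2.2.2.1
    · rw [ultraMap_mk]
      refine mk_eq_mk_of_forall_eventually ω fun ε hε => ?_
      filter_upwards [hx i ε hε] with n hn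
      exact hn.2.2.2.2
  · intro m
    have hε : (0 : ℝ) < 1 / ((m : ℝ) + 1) := by positivity
    obtain ⟨u, ⟨huJ, b, hb, rfl⟩, hu⟩ := h m _ hε
    obtain ⟨a, rfl, ha⟩ := Ultrapower.exists_norm_lt ω b (hb.trans_lt one_lt_two)
    rw [Ultrapower.star_mk, ← map_mul] at huJ hu
    have h1 : ∀ᶠ n in (ω : Filter ℕ), ‖a n‖ < 1 + 1 / ((m : ℝ) + 1) :=
      eventually_norm_lt ω (by linarith)
    have h2 : ∀ᶠ n in (ω : Filter ℕ), twoNorm ((star a * a) n) < 1 / ((m : ℝ) + 1) :=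
      (tendsto_ultraTwoNorm ω _).eventually_lt_const
        (by rwa [(mem_traceKernelIdeal ω).1 huJ])
    have h3 : ∀ᶠ n in (ω : Filter ℕ), ∀ i ∈ Finset.range m,
        ‖(star a * a * S i - S i) n‖ < 1 / ((m : ℝ) + 1) ∧
        ‖(star a * a * C i - C i * (star a * a)) n‖ < 1 / ((m : ℝ) + 1) ∧
        ‖(mapSeq (φ i) (star a * a) - star a * a) n‖ < 1 / ((m : ℝ) + 1) := by
      rw [Filter.eventually_all_finset]
      intro i hi
      obtain ⟨e1, e2, e3⟩ := hu i (Finset.mem_range.1 hi)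
      rw [← hS, ← map_mul, ← map_sub] at e1
      rw [← hC, ← map_mul, ← map_mul, ← map_sub] at e2
      rw [ultraMap_mk, ← map_sub] at e3
      filter_upwards [eventually_norm_lt ω e1, eventually_norm_lt ω e2,
        eventually_norm_lt ω e3] with n g1 g2 g3
      exact ⟨g1, g2, g3⟩
    filter_upwards [h1, h2, h3] with n g1 g2 g3
    refine ⟨⟨a n, (a.norm_coe_le_norm n).trans ha.le⟩, fun i hi => ?_⟩
    obtain ⟨e1, e2, e3⟩ := g3 i (Finset.mem_range.2 hi)
    simp only [ψ, max_lt_iff]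
    exact ⟨by linarith, g2, e1, e2, e3⟩

end Ultrapower

/-! ### Approximate units and averages of elements with orthogonal ranges -/

section CStar

variable {B : Type*} [CStarAlgebra B]

/-- Elements of a closed self-adjoint ideal admit approximate units consisting of positive
contractions. -/
theorem exists_approx_unit (J : TwoSidedIdeal B) (hJ : IsClosed (J : Set B))
    (hstar : ∀ x ∈ J, star x ∈ J) (S : Finset B) (hS : ∀ s ∈ S, s ∈ J) {ε : ℝ} (hε : 0 < ε) :
    ∃ b : B, star b * b ∈ J ∧ ‖b‖ ≤ 1 ∧ ∀ s ∈ S, ‖star b * b * s - s‖ < ε := by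
  -- The ideal is a non-unital C⋆-algebra in its own right, so it has an increasing approximate
  -- unit.
  let D : NonUnitalStarSubalgebra ℂ B :=
    { carrier := J
      add_mem' := J.add_mem
      zero_mem' := J.zero_mem
      mul_mem' := fun {a b} _ hb => J.mul_mem_left a b hb
      smul_mem' := fun c x hx => by
        -- A ring ideal absorbs scalars because `c • x = (c • 1) * x`.
        rw [← one_mul x, ← smul_mul_assoc]
        exact J.mul_mem_left _ _ hx
      star_mem' := fun {x} hx => hstar x hx }
  have hD : IsClosed (D : Set B) := hJ
  let _ : NonUnitalCStarAlgebra D := inferInstance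
  let _ := CStarAlgebra.spectralOrder D
  have _ := CStarAlgebra.spectralOrderedRing D
  have hl := CStarAlgebra.increasingApproximateUnit D
  have hS' : ∀ᶠ x : D in CStarAlgebra.approximateUnit D, ∀ s ∈ S.attach,
      ‖(x : B) * s.1 - s.1‖ < ε := by
    rw [Filter.eventually_all_finset]
    intro s _
    have h := hl.tendsto_mul_right (⟨s.1, hS s.1 s.2⟩ : D)
    filter_upwards [Metric.tendsto_nhds.1 h ε hε] with x hx
    rwa [dist_eq_norm] at hx
  obtain ⟨x, h0, h1, h2⟩ := (hl.eventually_nonneg.and (hl.eventually_norm.and hS')).exists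
  obtain ⟨b, rfl⟩ := CStarAlgebra.nonneg_iff_eq_star_mul_self.1 h0
  refine ⟨b, (star b * b).2, ?_, fun s hs => h2 ⟨s, hs⟩ (Finset.mem_attach _ _)⟩
  rw [CStarRing.norm_star_mul_self] at h1
  change ‖b‖ ≤ 1
  nlinarith [norm_nonneg b]

/-- A Pythagorean estimate: for $S = \sum_{i<N} f_i$ the cross terms of $(S+f_N)^*(S+f_N)$ vanish,
so the C⋆-identity gives $\|S+f_N\|^2 \le \|S\|^2 + \|f_N\|^2$. -/
theorem norm_sum_sq_le_of_star_mul_eq_zero {f : ℕ → B} {K : ℝ} (hK : ∀ i, ‖f i‖ ≤ K)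
    (hf : ∀ i j, i < j → star (f j) * f i = 0) (N : ℕ) :
    ‖∑ i ∈ Finset.range N, f i‖ ^ 2 ≤ N * K ^ 2 := by
  induction N with
  | zero => simp
  | succ N ih =>
    set S := ∑ i ∈ Finset.range N, f i with hS
    have h1 : star (f N) * S = 0 := by
      rw [hS, Finset.mul_sum]
      exact Finset.sum_eq_zero fun i hi => hf i N (Finset.mem_range.1 hi)
    have h2 : star S * f N = 0 := by
      rw [← star_star (star S * f N), star_mul, star_star, h1, star_zero]
    have h3 : star (S + f N) * (S + f N) = star S * S + star (f N) * f N := by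
      rw [star_add, add_mul, mul_add, mul_add, h1, h2]
      abel
    have h4 : ‖f N‖ ^ 2 ≤ K ^ 2 := pow_le_pow_left₀ (norm_nonneg _) (hK N) 2
    rw [Finset.sum_range_succ, sq, ← CStarRing.norm_star_mul_self, h3]
    refine (norm_add_le _ _).trans ?_
    rw [CStarRing.norm_star_mul_self, CStarRing.norm_star_mul_self, ← sq, ← sq]
    push_cast
    linarith

/-- The sum grows at most like $K\sqrt N$, so the average is at most $K/\sqrt N$. -/
theorem norm_average_le_of_star_mul_eq_zero {f : ℕ → B} {K : ℝ} (hK : ∀ i, ‖f i‖ ≤ K)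
    (hf : ∀ i j, i < j → star (f j) * f i = 0) {ε : ℝ} (hε : 0 < ε) :
    ∀ᶠ N : ℕ in Filter.atTop, ‖(N : ℝ)⁻¹ • ∑ i ∈ Finset.range N, f i‖ < ε := by
  have h : Filter.Tendsto (fun N : ℕ => K ^ 2 / (N : ℝ)) Filter.atTop (nhds 0) :=
    tendsto_const_div_atTop_nhds_zero_nat _
  filter_upwards [h.eventually_lt_const (pow_pos hε 2), Filter.eventually_gt_atTop 0] with N hN h0
  have hN0 : (0 : ℝ) < N := by exact_mod_cast h0
  refine lt_of_pow_lt_pow_left₀ 2 hε.le (lt_of_le_of_lt ?_ hN)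
  rw [norm_smul, mul_pow, norm_inv, Real.norm_of_nonneg hN0.le]
  calc (N : ℝ)⁻¹ ^ 2 * ‖∑ i ∈ Finset.range N, f i‖ ^ 2
      ≤ (N : ℝ)⁻¹ ^ 2 * (N * K ^ 2) :=
        mul_le_mul_of_nonneg_left (norm_sum_sq_le_of_star_mul_eq_zero hK hf N) (by positivity)
    _ = K ^ 2 / N := by field_simp

/-- Averages of positive contractions are positive contractions. -/
theorem exists_average_eq_star_mul_self {e : ℕ → B}
    (he : ∀ i, ∃ b, ‖b‖ ≤ 1 ∧ e i = star b * b) (N : ℕ) :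
    ∃ b, ‖b‖ ≤ 1 ∧ (N : ℝ)⁻¹ • ∑ i ∈ Finset.range N, e i = star b * b := by
  let _ := CStarAlgebra.spectralOrder B
  have _ := CStarAlgebra.spectralOrderedRing B
  have hnorm : ∀ i, ‖e i‖ ≤ 1 := fun i => by
    obtain ⟨b, hb, h⟩ := he i
    rw [h, CStarRing.norm_star_mul_self]
    nlinarith [norm_nonneg b]
  have hpos : ∀ i, 0 ≤ e i := fun i => by
    obtain ⟨b, -, h⟩ := he i
    rw [h]
    exact star_mul_self_nonneg b
  have h0 : 0 ≤ (N : ℝ)⁻¹ • ∑ i ∈ Finset.range N, e i :=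
    smul_nonneg (by positivity) (Finset.sum_nonneg fun i _ => hpos i)
  obtain ⟨b, hb⟩ := CStarAlgebra.nonneg_iff_eq_star_mul_self.1 h0
  refine ⟨b, ?_, hb⟩
  have h1 : ‖(N : ℝ)⁻¹ • ∑ i ∈ Finset.range N, e i‖ ≤ 1 := by
    rw [norm_smul, norm_inv, Real.norm_natCast]
    have hs : ‖∑ i ∈ Finset.range N, e i‖ ≤ N := by
      simpa using norm_sum_le_of_le (Finset.range N) fun i _ => hnorm i
    exact inv_mul_le_one_of_le₀ hs (Nat.cast_nonneg N)
  rw [hb, CStarRing.norm_star_mul_self] at h1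
  nlinarith [norm_nonneg b]

/-- Here `x` is an earlier and `y` a later term of the sequence of units. On expanding, `y` is
absorbed in each of the four products, which leaves $c^*xc - c^*cx - c^*xc + c^*cx$. -/
theorem star_commutator_mul_commutator_eq_zero {c x y : B} (hy : star y = y)
    (h1 : y * x = x) (h2 : y * (c * x) = c * x) (h3 : y * (star c * x) = star c * x)
    (h4 : y * (star c * c * x) = star c * c * x) :
    star (y * c - c * y) * (x * c - c * x) = 0 := by
  have e1 : star c * y * (x * c) = star c * x * c := by
    rw [mul_assoc, ← mul_assoc y, h1, mul_assoc]
  have e2 : star c * y * (c * x) = star c * c * x := by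
    rw [mul_assoc, h2, mul_assoc]
  have e3 : y * star c * (x * c) = star c * x * c := by
    rw [mul_assoc, ← mul_assoc (star c), ← mul_assoc, h3]
  have e4 : y * star c * (c * x) = star c * c * x := by
    rw [mul_assoc, ← mul_assoc (star c), h4]
  rw [star_sub, star_mul, star_mul, hy, sub_mul, mul_sub, mul_sub, e1, e2, e3, e4]
  abel

end CStar

/-! ### From exact units to invariant exact units that commute with given elements -/

section SigmaIdeal

variable {A : Type*} [CStarAlgebra A] (ω : Ultrafilter ℕ)

theorem norm_le_one_of_mem_kernelContractions {u : Ultrapower A ω}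
    (hu : u ∈ kernelContractions A ω) : ‖u‖ ≤ 1 := by
  obtain ⟨-, b, hb, rfl⟩ := hu
  rw [CStarRing.norm_star_mul_self]
  nlinarith [norm_nonneg b]

theorem star_eq_of_mem_kernelContractions {u : Ultrapower A ω}
    (hu : u ∈ kernelContractions A ω) : star u = u := by
  obtain ⟨-, b, -, rfl⟩ := hu
  rw [star_mul, star_star]

theorem norm_ultraMap (φ : A ≃⋆ₐ[ℂ] A) (x : Ultrapower A ω) : ‖ultraMap ω φ x‖ = ‖x‖ :=
  NonUnitalStarAlgHom.norm_map (ultraMap ω φ) (ultraMap ω φ).injective x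

/-- Countable subsets of `J_A` have an exact unit in `J_A`. -/
theorem exists_exact_unit (hω : (ω : Filter ℕ) ≤ Filter.cofinite) {S : Set (Ultrapower A ω)}
    (hS : S.Countable) (hSJ : ∀ s ∈ S, s ∈ traceKernelIdeal A ω) :
    ∃ u ∈ kernelContractions A ω, ∀ s ∈ S, u * s = s := by
  classical
  -- Adjoining 0 makes the set nonempty, hence the range of a sequence.
  obtain ⟨s, hs⟩ := (hS.insert 0).exists_eq_range (Set.insert_nonempty _ _)
  have hsJ : ∀ i, s i ∈ traceKernelIdeal A ω := fun i => by
    have : s i ∈ insert 0 S := hs ▸ Set.mem_range_self i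
    rcases this with h | h
    · rw [h]
      exact (traceKernelIdeal A ω).zero_mem
    · exact hSJ _ h
  -- With `c = 0` and identity automorphisms, only the unit relation has content.
  obtain ⟨u, hu, h⟩ := exists_mem_kernelContractions_of_approx ω hω s 0
    (fun _ => (1 : A ≃⋆ₐ[ℂ] A)) fun m ε hε => by
      obtain ⟨b, hbJ, hb, hbs⟩ := exists_approx_unit (traceKernelIdeal A ω)
        (isClosed_traceKernelIdeal ω) (fun x hx => star_mem_traceKernelIdeal ω hx)
        ((Finset.range m).image s) (by
          intro x hx
          obtain ⟨i, -, rfl⟩ := Finset.mem_image.1 hx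
          exact hsJ i) hε
      refine ⟨star b * b, ⟨hbJ, b, hb, rfl⟩, fun i hi => ⟨?_, ?_, ?_⟩⟩
      · exact hbs _ (Finset.mem_image_of_mem s (Finset.mem_range.2 hi))
      · simpa using hε
      · have h1 : ultraMap ω (1 : A ≃⋆ₐ[ℂ] A) = 1 := (ultraAction ω (1 : Unit →* _)).map_one
        rw [h1, StarAlgEquiv.one_apply, sub_self, norm_zero]
        exact hε
  refine ⟨u, hu, fun x hx => ?_⟩
  obtain ⟨i, rfl⟩ : x ∈ Set.range s := hs ▸ Set.mem_insert_of_mem 0 hx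
  exact (h i).1

/-- There is a sequence of exact units of a countable subset of `J_A`, each of which is a unit for
its predecessors as well as for their images under given multiplications and automorphisms. -/
theorem exists_seq_exact_units (hω : (ω : Filter ℕ) ≤ Filter.cofinite)
    (s c : ℕ → Ultrapower A ω) (φ : ℕ → (A ≃⋆ₐ[ℂ] A))
    (hs : ∀ i, s i ∈ traceKernelIdeal A ω) :
    ∃ e : ℕ → Ultrapower A ω, (∀ n, e n ∈ kernelContractions A ω ∧ ∀ i, e n * s i = s i) ∧
      ∀ m n, m < n → e n * e m = e m ∧ ∀ i, e n * (c i * e m) = c i * e m ∧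
        e n * (star (c i) * e m) = star (c i) * e m ∧
        e n * (star (c i) * c i * e m) = star (c i) * c i * e m ∧
        e n * ultraMap ω (φ i) (e m) = ultraMap ω (φ i) (e m) ∧
        e n * ultraMap ω (φ i).symm (e m) = ultraMap ω (φ i).symm (e m) := by
  refine exists_seq_of_forall_finset_exists
    (fun u : Ultrapower A ω => u ∈ kernelContractions A ω ∧ ∀ i, u * s i = s i)
    (fun x y : Ultrapower A ω => y * x = x ∧ ∀ i, y * (c i * x) = c i * x ∧
        y * (star (c i) * x) = star (c i) * x ∧
        y * (star (c i) * c i * x) = star (c i) * c i * x ∧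
        y * ultraMap ω (φ i) x = ultraMap ω (φ i) x ∧
        y * ultraMap ω (φ i).symm x = ultraMap ω (φ i).symm x) fun F hF => ?_
  -- All elements that the next term has to fix: a countable subset of `J_A`, as only finitely many
  -- terms precede.
  let E : Set (Ultrapower A ω) := Set.range s ∪ ⋃ x ∈ F, ({x} ∪ ⋃ i,
    {c i * x, star (c i) * x, star (c i) * c i * x, ultraMap ω (φ i) x, ultraMap ω (φ i).symm x})
  have hE : E.Countable := by
    refine (Set.countable_range s).union (F.countable_toSet.biUnion fun x _ => ?_)
    refine (Set.countable_singleton x).union (Set.countable_iUnion fun i => ?_)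
    exact (Set.toFinite _).countable
  have hEJ : ∀ x ∈ E, x ∈ traceKernelIdeal A ω := by
    rintro y (⟨i, rfl⟩ | hy)
    · exact hs i
    · simp only [Set.mem_iUnion] at hy
      obtain ⟨x, hx, hy⟩ := hy
      have hxJ := (hF x hx).1.1
      rcases hy with rfl | hy
      · exact hxJ
      · obtain ⟨i, hy⟩ := Set.mem_iUnion.1 hy
        rcases hy with rfl | rfl | rfl | rfl | rfl
        · exact (traceKernelIdeal A ω).mul_mem_left _ _ hxJ
        · exact (traceKernelIdeal A ω).mul_mem_left _ _ hxJ
        · exact (traceKernelIdeal A ω).mul_mem_left _ _ hxJ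
        · exact ultraMap_mem_traceKernelIdeal ω _ hxJ
        · exact ultraMap_mem_traceKernelIdeal ω _ hxJ
  obtain ⟨u, hu, h⟩ := exists_exact_unit ω hω hE hEJ
  refine ⟨u, ⟨hu, fun i => h _ (Or.inl ⟨i, rfl⟩)⟩, fun x hx => ?_⟩
  have hx' : ∀ z ∈ ({x} ∪ ⋃ i, {c i * x, star (c i) * x, star (c i) * c i * x,
      ultraMap ω (φ i) x, ultraMap ω (φ i).symm x} : Set (Ultrapower A ω)), u * z = z :=
    fun z hz => h z (Or.inr (Set.mem_biUnion (Finset.mem_coe.2 hx) hz))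
  refine ⟨hx' _ (Or.inl rfl), fun i => ?_⟩
  have hi : ∀ z ∈ ({c i * x, star (c i) * x, star (c i) * c i * x,
      ultraMap ω (φ i) x, ultraMap ω (φ i).symm x} : Set (Ultrapower A ω)), u * z = z :=
    fun z hz => hx' z (Or.inr (Set.mem_iUnion.2 ⟨i, hz⟩))
  exact ⟨hi _ (by simp), hi _ (by simp), hi _ (by simp), hi _ (by simp), hi _ (by simp)⟩

/-- Countably many elements of `J_A` have an exact unit in `J_A` that commutes with countably many
given elements of `A_ω` and is fixed by countably many given automorphisms. -/
theorem exists_quasicentral_exact_unit (hω : (ω : Filter ℕ) ≤ Filter.cofinite)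
    (s c : ℕ → Ultrapower A ω) (φ : ℕ → (A ≃⋆ₐ[ℂ] A))
    (hs : ∀ i, s i ∈ traceKernelIdeal A ω) :
    ∃ u ∈ kernelContractions A ω, ∀ i, u * s i = s i ∧ u * c i = c i * u ∧
      ultraMap ω (φ i) u = u := by
  obtain ⟨e, he, hee⟩ := exists_seq_exact_units ω hω s c φ hs
  have hnorm : ∀ i, ‖e i‖ ≤ 1 := fun i => norm_le_one_of_mem_kernelContractions ω (he i).1
  have hstar : ∀ i, star (e i) = e i := fun i => star_eq_of_mem_kernelContractions ω (he i).1
  refine exists_mem_kernelContractions_of_approx ω hω s c φ fun m ε hε => ?_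
  have hcomm : ∀ k, ∀ᶠ N : ℕ in Filter.atTop,
      ‖(N : ℝ)⁻¹ • ∑ i ∈ Finset.range N, (e i * c k - c k * e i)‖ < ε := fun k => by
    refine norm_average_le_of_star_mul_eq_zero (K := ‖c k‖ + ‖c k‖) (fun i => ?_)
      (fun i j hij => ?_) hε
    · refine (norm_sub_le _ _).trans (add_le_add ?_ ?_)
      · exact (norm_mul_le _ _).trans (mul_le_of_le_one_left (norm_nonneg _) (hnorm i))
      · exact (norm_mul_le _ _).trans (mul_le_of_le_one_right (norm_nonneg _) (hnorm i))
    · obtain ⟨h1, h⟩ := hee i j hij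
      obtain ⟨h2, h3, h4, -⟩ := h k
      exact star_commutator_mul_commutator_eq_zero (hstar j) h1 h2 h3 h4
  have hact : ∀ k, ∀ᶠ N : ℕ in Filter.atTop,
      ‖(N : ℝ)⁻¹ • ∑ i ∈ Finset.range N, (ultraMap ω (φ k) (e i) - e i)‖ < ε := fun k => by
    refine norm_average_le_of_star_mul_eq_zero (K := 1 + 1) (fun i => ?_)
      (fun i j hij => ?_) hε
    · refine (norm_sub_le _ _).trans (add_le_add ?_ (hnorm i))
      rw [norm_ultraMap]
      exact hnorm i
    · obtain ⟨h1, h⟩ := hee i j hij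
      obtain ⟨-, -, -, h5, h6⟩ := h k
      -- Apply `φ k` to the relation saying that `e j` is a unit for the preimage of `e i`; this is
      -- why inverse automorphisms enter the construction of `e`.
      have h7 : ultraMap ω (φ k) (e j) * e i = e i := by
        have h8 : ultraMap ω (φ k) (ultraMap ω (φ k).symm (e i)) = e i :=
          (ultraMap ω (φ k)).apply_symm_apply (e i)
        rw [← h8, ← map_mul, h6]
      -- The product becomes $\varphi(e_i) - e_i - \varphi(e_i) + e_i = 0$.
      rw [star_sub, ← map_star, hstar, sub_mul, mul_sub, mul_sub, ← map_mul, h1, h5, h7]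
      abel
  have hall : ∀ᶠ N : ℕ in Filter.atTop, ∀ k ∈ Finset.range m,
      ‖(N : ℝ)⁻¹ • ∑ i ∈ Finset.range N, (e i * c k - c k * e i)‖ < ε ∧
      ‖(N : ℝ)⁻¹ • ∑ i ∈ Finset.range N, (ultraMap ω (φ k) (e i) - e i)‖ < ε := by
    rw [Filter.eventually_all_finset]
    exact fun k _ => (hcomm k).and (hact k)
  obtain ⟨N, hN, hN0⟩ := (hall.and (Filter.eventually_gt_atTop 0)).exists
  have hN' : (N : ℝ) ≠ 0 := by exact_mod_cast hN0.ne'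
  refine ⟨(N : ℝ)⁻¹ • ∑ i ∈ Finset.range N, e i,
    ⟨?_, exists_average_eq_star_mul_self (fun i => (he i).1.2) N⟩, fun k hk => ⟨?_, ?_, ?_⟩⟩
  · rw [← one_mul (∑ i ∈ Finset.range N, e i), ← smul_mul_assoc]
    exact (traceKernelIdeal A ω).mul_mem_left _ _ (sum_mem fun i _ => (he i).1.1)
  · have : (N : ℝ)⁻¹ • (∑ i ∈ Finset.range N, e i) * s k = s k := by
      rw [smul_mul_assoc, Finset.sum_mul, Finset.sum_congr rfl fun i _ => (he i).2 k,
        Finset.sum_const, Finset.card_range, ← Nat.cast_smul_eq_nsmul ℝ, inv_smul_smul₀ hN']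
    rw [this, sub_self, norm_zero]
    exact hε
  · have := (hN k (Finset.mem_range.2 hk)).1
    rwa [Finset.sum_sub_distrib, ← Finset.sum_mul, ← Finset.mul_sum, smul_sub, ← smul_mul_assoc,
      ← mul_smul_comm] at this
  · have := (hN k (Finset.mem_range.2 hk)).2
    have hsmul : ∀ (r : ℝ) (x : Ultrapower A ω),
        ultraMap ω (φ k) (r • x) = r • ultraMap ω (φ k) x := fun r x => by
      rw [← Complex.coe_smul, map_smul, Complex.coe_smul]
    rwa [Finset.sum_sub_distrib, ← map_sum, smul_sub, ← hsmul] at this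

end SigmaIdeal

end TraceKernel

end

theorem mainTheorem10 {A : Type*} [CStarAlgebra A] [TopologicalSpace.SeparableSpace A]
    (hT : (TraceKernel.traceSpace A).Nonempty)
    {Γ : Type*} [Group Γ] [Countable Γ] (hΓ : TraceKernel.IsAmenable Γ)
    (ω : Ultrafilter ℕ) (hω : (ω : Filter ℕ) ≤ Filter.cofinite)
    (α : Γ →* (A ≃⋆ₐ[ℂ] A)) :
    TraceKernel.IsSigmaIdeal (TraceKernel.ultraAction ω α) (TraceKernel.traceKernelIdeal A ω) := by
  refine ⟨TraceKernel.isClosed_traceKernelIdeal ω, TraceKernel.image_traceKernelIdeal ω α,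
    fun C _ hsep _ => ?_⟩
  obtain ⟨D, -, hD, hCD⟩ := hsep.exists_countable_dense_subset
  -- A dense subset of `C` may miss `J_A` altogether, so `C ∩ J_A` needs a dense subset of its own.
  obtain ⟨E, hEJ, hE, hJE⟩ := (hsep.mono (Set.inter_subset_left
    (t := (TraceKernel.traceKernelIdeal A ω : Set _)))).exists_countable_dense_subset
  obtain ⟨c, hc⟩ := (hD.insert 0).exists_eq_range (Set.insert_nonempty _ _)
  obtain ⟨s, hs⟩ := (hE.insert 0).exists_eq_range (Set.insert_nonempty _ _)
  obtain ⟨g, hg⟩ := exists_surjective_nat Γ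
  have hsJ : ∀ i, s i ∈ TraceKernel.traceKernelIdeal A ω := fun i => by
    have : s i ∈ insert 0 E := hs ▸ Set.mem_range_self i
    rcases this with h | h
    · rw [h]
      exact (TraceKernel.traceKernelIdeal A ω).zero_mem
    · exact (hEJ h).2
  obtain ⟨u, hu, h⟩ := TraceKernel.exists_quasicentral_exact_unit ω hω s c (fun i => α (g i)) hsJ
  refine ⟨u, hu.1, ?_, TraceKernel.norm_le_one_of_mem_kernelContractions ω hu, fun x hx => ?_,
    fun γ => ?_, fun x hx hxJ => ?_⟩
  · obtain ⟨-, b, -, hb⟩ := hu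
    exact ⟨b, hb⟩
  -- Both this relation and `u * y = y` are closed conditions on `y`, so they extend from the dense
  -- sequences.
  · have hcl : IsClosed {y : TraceKernel.Ultrapower A ω | u * y = y * u} :=
      isClosed_eq (continuous_const.mul continuous_id) (continuous_id.mul continuous_const)
    refine closure_minimal (fun y hy => ?_) hcl (hCD hx)
    obtain ⟨i, rfl⟩ : y ∈ Set.range c := hc ▸ Set.mem_insert_of_mem 0 hy
    exact (h i).2.1
  · obtain ⟨i, rfl⟩ := hg γ
    exact (h i).2.2
  · have hcl : IsClosed {y : TraceKernel.Ultrapower A ω | u * y = y} :=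
      isClosed_eq (continuous_const.mul continuous_id) continuous_id
    refine closure_minimal (fun y hy => ?_) hcl (hJE ⟨hx, hxJ⟩)
    obtain ⟨i, rfl⟩ : y ∈ Set.range s := hs ▸ Set.mem_insert_of_mem 0 hy
    exact (h i).1
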